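/- Notation. A real $r$ is computable if $\{q\in\mathbb{Q}: q<r\}$ and $\{q\in\mathbb{Q}: q<-r\}$ are computably enumerable. On $\{0,1\}^{\mathbb{Z}}\times\{0,1\}^{\mathbb{Z}}$ (spins $x$, scatterers $y$) let $$\varphi(x,y)(i)=\bigl(x(i-1)+y(i-1)-2x(i-1)y(i-1),\;y(i)\bigr),\qquad \pi(x,y)(i)=\bigl(x(-i),\,y(-i-1)\bigr)$$ be one time step of the Kac infinite chain and the time-reversal transformation. For $m=(m_0,m_1)\in[-1,1]\times[0,1]$ let $\mu_m=\mu_{(1+m_0)/2}\times\mu_{m_1}$, where $\mu_p$ is the Bernoulli measure on $\{0,1\}^{\mathbb{Z}}$ (independent coordinates, each equal to $1$ with probability $p$), and let $\mu_{m,t}=\mu_m\circ\varphi^{-t}$ be the image of $\mu_m$ under $\varphi^t$, the measure at time $t$. For a probability measure $\mu$ on $\{0,1\}^{\mathbb{N}}$, a sequence $z$ is Martin-Löf $\mu$-random if there is no sequence $(U_n)_{n\in\mathbb{N}}$ of sets, c.e. open uniformly in $n$, with $\mu(U_n)\le 2^{-n}$ and $z\in U_n$ for all $n$. A pair $(x,y)\in\{0,1\}^{\mathbb{Z}}\times\{0,1\}^{\mathbb{Z}}$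 is Martin-Löf random with respect to $\mu$ if its code $\kappa(\iota(x),\iota(y))$ is Martin-Löf random with respect to the image of $\mu$ under this coding, where $\iota(x)=x(0)x(-1)x(1)x(-2)x(2)\cdots$ and $\kappa(a,b)=a(0)b(0)a(1)b(1)\cdots$. Theorem (non-randomness of the time-reversed state). Let $m_0\in[-1,1]$ and $m_1\in[0,1]$ be computable reals with $m_0\neq 0$ and $m_1\notin\{0,\tfrac12,1\}$. Then for every $(x,y)$ that is Martin-Löf random with respect to $\mu_m$ and every integer $t\ge 1$, the time-reversed state $(\pi\circ\varphi^t)(x,y)$ is not Martin-Löf random with respect to $\mu_{m,t}$. -/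

import Mathlib

open MeasureTheory ProbabilityTheory
open scoped ENNReal

/-! ### Computable reals -/

/-- The rational number `(-1)^s * p / (q + 1)` named by the triple `(s, p, q)`. -/
def codedRat (c : Bool × ℕ × ℕ) : ℚ :=
  (if c.1 then -1 else 1) * ((c.2.1 : ℚ) / ((c.2.2 : ℚ) + 1))

/-- `r` is lower semicomputable: the set of rationals `< r` is computably enumerable. -/
def LowerSemicomputable (r : ℝ) : Prop :=
  REPred fun c : Bool × ℕ × ℕ => ((codedRat c : ℚ) : ℝ) < r

/-- `r` is computable: both `r` and `-r` are lower semicomputable. -/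
def ComputableReal (r : ℝ) : Prop :=
  LowerSemicomputable r ∧ LowerSemicomputable (-r)

/-! ### Martin-Löf randomness in Cantor space -/

/-- The cylinder `[σ]`: all infinite binary sequences having `σ` as a prefix. -/
def cylinderSet (σ : List Bool) : Set (ℕ → Bool) :=
  {x | ∀ (i : ℕ) (hi : i < σ.length), x i = σ[i]}

/-- `U 0, U 1, …` are c.e. open, uniformly in the index. -/
def UniformlyCEOpen (U : ℕ → Set (ℕ → Bool)) : Prop :=
  ∃ S : ℕ → Set (List Bool),
    (REPred fun p : ℕ × List Bool => p.2 ∈ S p.1) ∧ ∀ n, U n = ⋃ σ ∈ S n, cylinderSet σ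

/-- A Martin-Löf test with respect to `μ`. -/
def IsMLTest (μ : Measure (ℕ → Bool)) (U : ℕ → Set (ℕ → Bool)) : Prop :=
  UniformlyCEOpen U ∧ ∀ n, μ (U n) ≤ (2⁻¹ : ℝ≥0∞) ^ n

/-- Martin-Löf randomness on `{0,1}^ℕ`: `{z}` is not a Martin-Löf null set. -/
def MLRandomNat (μ : Measure (ℕ → Bool)) (z : ℕ → Bool) : Prop :=
  ¬ ∃ U : ℕ → Set (ℕ → Bool), IsMLTest μ U ∧ {z} ⊆ ⋂ n, U n

/-! ### Two-sided configurations and pairs of them -/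

/-- Microscopic states `(x, y)`, with spins `x` and scatterers `y` on the lattice `ℤ`. -/
abbrev MicroState : Type := (ℤ → Bool) × (ℤ → Bool)

/-- The coding `x ↦ x(0) x(-1) x(1) x(-2) x(2) …`. -/
def iotaCode (x : ℤ → Bool) : ℕ → Bool := fun n =>
  if n % 2 = 0 then x ((n / 2 : ℕ) : ℤ) else x (-(((n + 1) / 2 : ℕ) : ℤ))

/-- The coding `(x, y) ↦ x(0) y(0) x(1) y(1) …`. -/
def kappaCode (p : (ℕ → Bool) × (ℕ → Bool)) : ℕ → Bool := fun n =>
  if n % 2 = 0 then p.1 (n / 2) else p.2 (n / 2)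

/-- The coding of a microscopic state by one infinite binary sequence. -/
def stateCode (s : MicroState) : ℕ → Bool := kappaCode (iotaCode s.1, iotaCode s.2)

/-- Martin-Löf randomness of a microscopic state, through the coding. -/
def MLRandom (μ : Measure MicroState) (s : MicroState) : Prop :=
  MLRandomNat (μ.map stateCode) (stateCode s)

/-! ### The Kac infinite chain -/

/-- One time step: particles move one site to the right, and a spin is flipped exactly when
there is a scatterer at the site it leaves. -/
def kacStep (s : MicroState) : MicroState :=
  (fun i => xor (s.1 (i - 1)) (s.2 (i - 1)), s.2)

/-- The time-reversal transformation. -/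
def timeReversal (s : MicroState) : MicroState :=
  (fun i => s.1 (-i), fun i => s.2 (-i - 1))

/-- The Bernoulli measure on `{0,1}^ℤ`: independent sites, each equal to `1` with
probability `p`. -/
noncomputable def bernoulliInt (p : unitInterval) : Measure (ℤ → Bool) :=
  Measure.infinitePi fun _ : ℤ => bernoulliMeasure true false p

/-- The probability `(1 + m₀) / 2` of an up spin when the mean magnetization is `m₀`. -/
noncomputable def upProb (m₀ : Set.Icc (-1 : ℝ) 1) : unitInterval :=
  ⟨(1 + (m₀ : ℝ)) / 2, by
    have h := m₀.2
    constructor <;> linarith [h.1, h.2]⟩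

/-- The measure `μ_m`: a product of Bernoulli measures, of parameter `(1 + m₀) / 2` for the spins
and `m₁` for the scatterers. -/
noncomputable def gibbsMeasure (m₀ : Set.Icc (-1 : ℝ) 1) (m₁ : unitInterval) :
    Measure MicroState :=
  (bernoulliInt (upProb m₀)).prod (bernoulliInt m₁)

/-- The measure at time `t`: the image of `μ_m` under `t` time steps. -/
noncomputable def gibbsMeasureAt (m₀ : Set.Icc (-1 : ℝ) 1) (m₁ : unitInterval) (t : ℕ) :
    Measure MicroState :=
  (gibbsMeasure m₀ m₁).map (kacStep^[t])

/-! After `t` steps a spin has been multiplied (in signs) by the `t` scatterers it crossed. For a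
state with law `μ_{m,t}`, multiplying the spin at `i` by the scatterers at `i - t, …, i - 1` undoes
this and leaves an initial spin, of mean sign `-m₀`. In the time-reversed state the same product
reads an initial spin and `2t` distinct initial scatterers, because reflection puts the visible
scatterers on the other side of the spin and nothing cancels; under `μ_m` its mean is `-m₀ (1 - 2
m₁)^(2t)`, strictly closer to `0`.

Along blocks at the sites `i = 2t(j + 1)` these products are pairwise independent, so Chebyshev and
an effective Borel–Cantelli argument (`MLRandomNat.eventually_oddCount`) keep the frequency of odd
blocks of a random state on the correct side of any rational threshold other than its expected
value. By `parity_timeReversal` the block counts of the reversed state are also counts of the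
initial state. A rational between the two expected frequencies gives the contradiction. -/

/-! ### An effective Borel–Cantelli lemma -/

theorem mem_cylinderSet_iff (σ : List Bool) (w : ℕ → Bool) :
    w ∈ cylinderSet σ ↔ (List.range σ.length).map w = σ := by
  constructor
  · intro h
    refine List.ext_getElem (by simp) fun i hi hi' => ?_
    simpa using h i hi'
  · intro h i hi
    have := congrArg (fun l : List Bool => l[i]?) h
    simpa [hi] using this

theorem MLRandomNat.eventually_not {μ : Measure (ℕ → Bool)} {z : ℕ → Bool}
    (hz : MLRandomNat μ z) {Q : ℕ → List Bool → Prop} (hQ : PrimrecRel Q)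
    {L : ℕ → ℕ} (hL : Primrec L) (hkL : ∀ k, k < L k) {C : ℝ≥0∞} (hC : C ≠ ⊤)
    (hμ : ∀ k, μ {w | Q k ((List.range (L k)).map w)} ≤ C * 2⁻¹ ^ k) :
    ∀ᶠ k in Filter.atTop, ¬ Q k ((List.range (L k)).map z) := by
  by_contra hcon
  have hfreq : ∃ᶠ k in Filter.atTop, Q k ((List.range (L k)).map z) := by
    simpa [Filter.Frequently] using hcon
  -- Shifting the index by `c` absorbs the tail sum `∑_{k ≥ n + c} C 2⁻ᵏ = 2C · 2⁻ᶜ · 2⁻ⁿ`.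
  obtain ⟨c, hc⟩ : ∃ c : ℕ, C * 2 ≤ 2 ^ c := by
    obtain ⟨c, hc⟩ := ENNReal.exists_nat_gt (ENNReal.mul_ne_top hC ENNReal.ofNat_ne_top (b := 2))
    refine ⟨c, hc.le.trans ?_⟩
    exact_mod_cast c.lt_two_pow_self.le
  -- Since `k < L k`, the search for `k` is bounded by the length of `σ`, so membership is primitive
  -- recursive.
  let S : ℕ → Set (List Bool) := fun n =>
    {σ | ∃ k < σ.length, n + c ≤ k ∧ σ.length = L k ∧ Q k σ}
  refine hz ⟨fun n => ⋃ σ ∈ S n, cylinderSet σ, ⟨⟨S, ?_, fun _ => rfl⟩, fun n => ?_⟩, ?_⟩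
  · have hR : PrimrecRel fun (k : ℕ) (p : ℕ × List Bool) =>
        p.1 + c ≤ k ∧ p.2.length = L k ∧ Q k p.2 := by
      have hk : Primrec fun x : ℕ × ℕ × List Bool => x.1 := Primrec.fst
      have hn : Primrec fun x : ℕ × ℕ × List Bool => x.2.1 := Primrec.fst.comp Primrec.snd
      have hσ : Primrec fun x : ℕ × ℕ × List Bool => x.2.2 := Primrec.snd.comp Primrec.snd
      exact (Primrec.nat_le.comp (Primrec.nat_add.comp hn (Primrec.const c)) hk).and
        ((Primrec.eq.comp (Primrec.list_length.comp hσ) (hL.comp hk)).and (hQ.comp hk hσ))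
    have hS := hR.exists_mem_list.comp
      (Primrec.list_range.comp (Primrec.list_length.comp Primrec.snd))
      (Primrec.id (α := ℕ × List Bool))
    refine (hS.of_eq (q := fun p : ℕ × List Bool => p.2 ∈ S p.1) fun p => ?_).computablePred.to_re
    simp [S]
  · have hsub : (⋃ σ ∈ S n, cylinderSet σ) ⊆
        ⋃ i : ℕ, {w | Q (n + c + i) ((List.range (L (n + c + i))).map w)} := by
      intro w hw
      simp only [Set.mem_iUnion] at hw ⊢
      obtain ⟨σ, ⟨k, -, hnk, hlen, hq⟩, hw⟩ := hw
      obtain ⟨i, rfl⟩ := Nat.exists_eq_add_of_le hnk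
      rw [mem_cylinderSet_iff, hlen] at hw
      exact ⟨i, by simpa [hw] using hq⟩
    calc μ (⋃ σ ∈ S n, cylinderSet σ)
        ≤ ∑' i : ℕ, C * 2⁻¹ ^ (n + c + i) :=
          (measure_mono hsub).trans ((measure_iUnion_le _).trans
            (ENNReal.tsum_le_tsum fun i => hμ _))
      _ = C * 2 * 2⁻¹ ^ c * 2⁻¹ ^ n := by
          simp_rw [pow_add, ENNReal.tsum_mul_left, ENNReal.tsum_geometric]
          rw [ENNReal.one_sub_inv_two, inv_inv]
          ring
      _ ≤ 2 ^ c * 2⁻¹ ^ c * 2⁻¹ ^ n := by gcongr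
      _ = 2⁻¹ ^ n := by
          rw [← mul_pow, ENNReal.mul_inv_cancel (by simp) (by simp), one_pow, one_mul]
  · rintro _ rfl
    refine Set.mem_iInter.2 fun n => ?_
    obtain ⟨k, hk, hq⟩ := Filter.frequently_atTop.1 hfreq (n + c)
    refine Set.mem_iUnion₂.2 ⟨(List.range (L k)).map _, ⟨k, ?_, hk, ?_, hq⟩, ?_⟩
    · simpa using hkL k
    · simp
    · simp [mem_cylinderSet_iff]

/-! ### Parities over blocks of positions -/

/-- The sum modulo `2` of the entries of `z` at the positions in `l`. -/
def parity (z : ℕ → Bool) (l : List ℕ) : Bool :=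
  l.foldr (fun p b => xor (z p) b) false

/-- The number of `j < N` such that the entries of `z` in the block `P j` have an odd sum. -/
def oddCount (P : ℕ → List ℕ) (z : ℕ → Bool) (N : ℕ) : ℕ :=
  N.rec 0 fun j c => if parity z (P j) = true then c + 1 else c

theorem primrec_parity {α : Type*} [Primcodable α] {f : α → List Bool} {l : α → List ℕ}
    (hf : Primrec f) (hl : Primrec l) :
    Primrec fun a => parity (fun p => (f a).getD p false) (l a) := by
  refine (Primrec.list_foldr (h := fun a y => xor ((f a).getD y.1 false) y.2) hl
    (Primrec.const false) ?_).of_eq fun _ => rfl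
  refine (Primrec.dom_finite (fun p : Bool × Bool => xor p.1 p.2)).comp (Primrec.pair ?_ ?_)
  · exact (Primrec.list_getD false).comp (hf.comp Primrec.fst) (Primrec.fst.comp Primrec.snd)
  · exact Primrec.snd.comp Primrec.snd

theorem primrec_oddCount {P : ℕ → List ℕ} (hP : Primrec P) :
    Primrec fun x : ℕ × List Bool => oddCount P (fun p => x.2.getD p false) (4 ^ x.1) := by
  have hpow : Primrec fun x : ℕ × List Bool => 4 ^ x.1 :=
    (Primrec₂.unpaired'.1 Nat.Primrec.pow).comp (Primrec.const 4) Primrec.fst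
  refine (Primrec.nat_rec' (h := fun x y =>
    if parity (fun p => x.2.getD p false) (P y.1) = true then y.2 + 1 else y.2) hpow
    (Primrec.const 0) ?_).of_eq fun _ => rfl
  have hc : Primrec fun y : (ℕ × List Bool) × ℕ × ℕ => y.2.2 := Primrec.snd.comp Primrec.snd
  refine Primrec.ite (Primrec.eq.comp (primrec_parity ?_ ?_) (Primrec.const true))
    (Primrec.succ.comp hc) hc
  · exact Primrec.snd.comp Primrec.fst
  · exact hP.comp (Primrec.fst.comp Primrec.snd)

theorem parity_congr {z w : ℕ → Bool} {l : List ℕ} (h : ∀ p ∈ l, z p = w p) :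
    parity z l = parity w l := by
  induction l with
  | nil => rfl
  | cons a l ih =>
    simp only [parity, List.foldr_cons] at ih ⊢
    rw [h a (by simp), ih fun p hp => h p (by simp [hp])]

theorem oddCount_congr {P : ℕ → List ℕ} {z w : ℕ → Bool} {N : ℕ}
    (h : ∀ j < N, parity z (P j) = parity w (P j)) : oddCount P z N = oddCount P w N := by
  induction N with
  | zero => rfl
  | succ N ih =>
    have := ih fun j hj => h j (by omega)
    simp only [oddCount] at this ⊢
    rw [this, h N (by omega)]

/-- The sign `-1` of `true` and `1` of `false`. -/
def sgn (b : Bool) : ℝ := if b then -1 else 1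

theorem sgn_xor (a b : Bool) : sgn (xor a b) = sgn a * sgn b := by
  cases a <;> cases b <;> simp [sgn]

theorem sgn_mul_self (a : Bool) : sgn a * sgn a = 1 := by
  cases a <;> simp [sgn]

theorem abs_sgn (a : Bool) : |sgn a| = 1 := by
  cases a <;> simp [sgn]

theorem sgn_injective : Function.Injective sgn := by
  intro a b
  cases a <;> cases b <;> norm_num [sgn]

theorem measurable_sgn : Measurable sgn := measurable_of_countable _

/-- Signs turn sums modulo `2` into products, whose expectations factor over independent sites. -/
theorem sgn_parity (z : ℕ → Bool) (l : List ℕ) :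
    sgn (parity z l) = (l.map fun p => sgn (z p)).prod := by
  induction l with
  | nil => simp [parity, sgn]
  | cons a l ih =>
    rw [List.map_cons, List.prod_cons, ← ih, ← sgn_xor]
    rfl

theorem sum_sgn_parity (P : ℕ → List ℕ) (z : ℕ → Bool) (N : ℕ) :
    ∑ j ∈ Finset.range N, sgn (parity z (P j)) = N - 2 * oddCount P z N := by
  induction N with
  | zero => simp [oddCount]
  | succ N ih =>
    rw [Finset.sum_range_succ, ih]
    simp only [oddCount]
    cases parity z (P N) <;> simp [sgn] <;> ring

theorem measurable_parity (l : List ℕ) : Measurable fun z : ℕ → Bool => parity z l := by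
  induction l with
  | nil => exact measurable_const
  | cons a l ih =>
    exact (measurable_of_countable fun p : Bool × Bool => xor p.1 p.2).comp
      ((measurable_pi_apply a).prodMk ih)

/-! ### A law of large numbers for random sequences -/

/-- Chebyshev with pairwise uncorrelated variables: each variance is `1 - e ^ 2 ≤ 1`, so the
variance of the sum is at most `N`. -/
theorem measure_deviation_le {Ω : Type*} [MeasurableSpace Ω] {ν : Measure Ω}
    [IsProbabilityMeasure ν] {X : ℕ → Ω → ℝ} (hX : ∀ j, Measurable (X j))
    (habs : ∀ j w, |X j w| = 1) {e : ℝ} (hmean : ∀ j, ∫ w, X j w ∂ν = e)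
    (hcov : ∀ i j, i ≠ j → ∫ w, X i w * X j w ∂ν = e ^ 2) {δ : ℝ} (hδ : 0 < δ) {N : ℕ}
    (hN : 0 < N) :
    ν {w | δ * N ≤ |∑ j ∈ Finset.range N, X j w - N * e|} ≤ ENNReal.ofReal (1 / (δ ^ 2 * N)) := by
  have hL : ∀ j, MemLp (X j) 2 ν := fun j =>
    MemLp.of_bound (hX j).aestronglyMeasurable 1 (by simp [habs])
  have hsum : MemLp (∑ j ∈ Finset.range N, X j) 2 ν := memLp_finsetSum' _ fun j _ => hL j
  have hE : ∫ w, (∑ j ∈ Finset.range N, X j) w ∂ν = N * e := by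
    simp only [Finset.sum_apply]
    rw [integral_finsetSum _ fun j _ => (hL j).integrable (by norm_num)]
    simp [hmean]
  have hV : Var[∑ j ∈ Finset.range N, X j; ν] ≤ N := by
    rw [variance_sum' fun j _ => hL j]
    calc _ ≤ ∑ i ∈ Finset.range N, ∑ j ∈ Finset.range N, if i = j then (1 : ℝ) else 0 := by
          refine Finset.sum_le_sum fun i _ => Finset.sum_le_sum fun j _ => ?_
          rw [covariance_eq_sub (hL i) (hL j)]
          simp only [Pi.mul_apply, hmean]
          split_ifs with hij
          · subst hij
            have : ∀ w, X i w * X i w = 1 := fun w => by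
              rw [← abs_mul_abs_self, habs, one_mul]
            simp only [this, integral_const, probReal_univ, smul_eq_mul, mul_one]
            nlinarith [mul_self_nonneg e]
          · rw [hcov i j hij]
            nlinarith
      _ = N := by simp [Finset.filter_true_of_mem]
  have hN' : (0 : ℝ) < N := by exact_mod_cast hN
  have := meas_ge_le_variance_div_sq hsum (mul_pos hδ hN')
  rw [hE] at this
  simp only [Finset.sum_apply] at this
  refine this.trans (ENNReal.ofReal_le_ofReal ?_)
  rw [div_le_div_iff₀ (by positivity) (by positivity)]
  nlinarith [mul_le_mul_of_nonneg_right hV (by positivity : 0 ≤ δ ^ 2 * N)]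

/-- Sampling at `N = 4 ^ k` makes the Chebyshev bounds summable. The reals `e` and `δ` enter only
the measure estimate; the test itself sees only `R`. -/
theorem MLRandomNat.eventually_oddCount {ν : Measure (ℕ → Bool)} [IsProbabilityMeasure ν]
    {z : ℕ → Bool} (hz : MLRandomNat ν z) {P : ℕ → List ℕ} (hP : Primrec P) {K : ℕ}
    (hK : ∀ j, ∀ p ∈ P j, p < K * (j + 1)) {e : ℝ}
    (hmean : ∀ j, ∫ w, sgn (parity w (P j)) ∂ν = e)
    (hcov : ∀ i j, i ≠ j → ∫ w, sgn (parity w (P i)) * sgn (parity w (P j)) ∂ν = e ^ 2)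
    {R : ℕ → ℕ → Prop} (hR : PrimrecRel R) {δ : ℝ} (hδ : 0 < δ)
    (hRδ : ∀ c N : ℕ, R c N → δ * N ≤ |(N - 2 * c : ℝ) - N * e|) :
    ∀ᶠ k in Filter.atTop, ¬ R (oddCount P z (4 ^ k)) (4 ^ k) := by
  -- `K * 4 ^ k` covers every position in the first `4 ^ k` blocks; `k + 1` secures `k < L k`.
  let L : ℕ → ℕ := fun k => K * 4 ^ k + k + 1
  have hpow : Primrec fun k : ℕ => 4 ^ k :=
    (Primrec₂.unpaired'.1 Nat.Primrec.pow).comp (Primrec.const 4) Primrec.id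
  have hL : Primrec L :=
    Primrec.succ.comp (Primrec.nat_add.comp (Primrec.nat_mul.comp (Primrec.const K) hpow)
      Primrec.id)
  let Q : ℕ → List Bool → Prop := fun k σ =>
    R (oddCount P (fun p => σ.getD p false) (4 ^ k)) (4 ^ k)
  have hQ : PrimrecRel Q := hR.comp (primrec_oddCount hP) (hpow.comp Primrec.fst)
  have hQR : ∀ k w, Q k ((List.range (L k)).map w) ↔ R (oddCount P w (4 ^ k)) (4 ^ k) := by
    intro k w
    have : oddCount P (fun p => ((List.range (L k)).map w).getD p false) (4 ^ k)
        = oddCount P w (4 ^ k) := by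
      -- All positions read lie below `L k`, so the default `false` of `getD` is never used.
      refine oddCount_congr fun j hj => parity_congr fun p hp => ?_
      have h1 : p < L k := by
        have h2 : K * (j + 1) ≤ K * 4 ^ k := Nat.mul_le_mul_left K hj
        have := hK j p hp
        simp only [L]
        omega
      simp [List.getD, h1]
    simp only [Q, this]
  have h := hz.eventually_not hQ hL (fun k => by simp only [L]; omega)
    (C := ENNReal.ofReal (1 / δ ^ 2)) ENNReal.ofReal_ne_top fun k => ?_
  · simpa only [hQR] using h
  · simp only [hQR]
    have hsub : {w | R (oddCount P w (4 ^ k)) (4 ^ k)} ⊆ {w | δ * (4 ^ k : ℕ) ≤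
        |∑ j ∈ Finset.range (4 ^ k), sgn (parity w (P j)) - (4 ^ k : ℕ) * e|} := by
      intro w hw
      rw [Set.mem_ofPred_eq, sum_sgn_parity]
      exact hRδ _ _ hw
    refine (measure_mono hsub).trans ((measure_deviation_le
      (fun j => measurable_sgn.comp (measurable_parity (P j))) (fun _ _ => abs_sgn _) hmean hcov
      hδ (by positivity)).trans ?_)
    have h2 : (2⁻¹ : ℝ≥0∞) ^ k = ENNReal.ofReal ((2⁻¹ : ℝ) ^ k) := by
      rw [ENNReal.ofReal_pow (by norm_num), ENNReal.ofReal_inv_of_pos (by norm_num)]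
      simp
    rw [h2, ← ENNReal.ofReal_mul (by positivity)]
    refine ENNReal.ofReal_le_ofReal ?_
    push_cast
    rw [one_div_mul_eq_div, div_le_div_iff₀ (by positivity) (by positivity), inv_pow,
      one_mul, ← mul_assoc, mul_comm _ (δ ^ 2), mul_assoc]
    refine le_mul_of_one_le_right (by positivity) ?_
    rw [← inv_pow, ← mul_pow]
    exact one_le_pow₀ (by norm_num)

instance (p : unitInterval) : IsProbabilityMeasure (bernoulliInt p) := by
  unfold bernoulliInt
  infer_instance

instance (m₀ : Set.Icc (-1 : ℝ) 1) (m₁ : unitInterval) :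
    IsProbabilityMeasure (gibbsMeasure m₀ m₁) := by
  unfold gibbsMeasure
  infer_instance

/-! ### Expectations of products of signs -/

theorem integral_prod_sgn_bernoulliInt (p : unitInterval) (A : Finset ℤ) :
    ∫ x, ∏ a ∈ A, sgn (x a) ∂bernoulliInt p = (1 - 2 * (p : ℝ)) ^ A.card := by
  have h1 : ∀ x : ℤ → Bool, ∏ a ∈ A, sgn (x a) = ∏ a : A, sgn (A.restrict x a) := fun x => by
    rw [← Finset.prod_coe_sort]
    rfl
  simp only [h1, bernoulliInt]
  refine (integral_restrict_infinitePi (X := fun _ : ℤ => Bool)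
    (fun _ : ℤ => bernoulliMeasure true false p) (s := A)
    (f := fun y : A → Bool => ∏ a : A, sgn (y a))
    (measurable_of_countable _).aestronglyMeasurable).trans ?_
  rw [integral_fintype_prod_eq_prod (fun _ : A => sgn)]
  simp only [integral_bernoulliMeasure, Finset.prod_const, Finset.card_univ, Fintype.card_coe]
  simp only [sgn, smul_eq_mul]
  norm_num
  ring

theorem integral_prod_sgn_gibbsMeasure (m₀ : Set.Icc (-1 : ℝ) 1) (m₁ : unitInterval)
    (A B : Finset ℤ) :
    ∫ s, (∏ a ∈ A, sgn (s.1 a)) * ∏ b ∈ B, sgn (s.2 b) ∂gibbsMeasure m₀ m₁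
      = (-(m₀ : ℝ)) ^ A.card * (1 - 2 * (m₁ : ℝ)) ^ B.card := by
  rw [gibbsMeasure, integral_prod_mul (fun x : ℤ → Bool => ∏ a ∈ A, sgn (x a))
    (fun y : ℤ → Bool => ∏ b ∈ B, sgn (y b)), integral_prod_sgn_bernoulliInt,
    integral_prod_sgn_bernoulliInt]
  congr 2
  simp only [upProb]
  ring

/-! ### The coding of microscopic states -/

theorem measurable_stateCode : Measurable stateCode := by
  refine measurable_pi_lambda _ fun n => ?_
  simp only [stateCode, kappaCode, iotaCode]
  split_ifs <;> fun_prop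

theorem measurable_kacStep : Measurable kacStep := by
  refine Measurable.prodMk (measurable_pi_lambda _ fun i => ?_) measurable_snd
  exact (measurable_of_countable fun p : Bool × Bool => xor p.1 p.2).comp
    (by fun_prop : Measurable fun s : MicroState => (s.1 (i - 1), s.2 (i - 1)))

theorem stateCode_four_mul (s : MicroState) (i : ℕ) : stateCode s (4 * i) = s.1 i := by
  have h1 : 4 * i % 2 = 0 := by omega
  have h2 : 4 * i / 2 = 2 * i := by omega
  simp [stateCode, kappaCode, iotaCode, h1, h2]

theorem stateCode_four_mul_add_one (s : MicroState) (i : ℕ) :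
    stateCode s (4 * i + 1) = s.2 i := by
  have h1 : (4 * i + 1) % 2 = 1 := by omega
  have h2 : (4 * i + 1) / 2 = 2 * i := by omega
  simp [stateCode, kappaCode, iotaCode, h1, h2]

theorem stateCode_four_mul_add_two (s : MicroState) (i : ℕ) :
    stateCode s (4 * i + 2) = s.1 (-(i : ℤ) - 1) := by
  have h1 : (4 * i + 2) % 2 = 0 := by omega
  have h2 : (4 * i + 2) / 2 = 2 * i + 1 := by omega
  have h3 : (2 * i + 1) % 2 = 1 := by omega
  have h4 : (2 * i + 1 + 1) / 2 = i + 1 := by omega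
  simp only [stateCode, kappaCode, iotaCode, h1, h2, h3, h4, if_true, one_ne_zero, if_false]
  refine congrArg s.1 ?_
  push_cast
  ring

theorem stateCode_four_mul_add_three (s : MicroState) (i : ℕ) :
    stateCode s (4 * i + 3) = s.2 (-(i : ℤ) - 1) := by
  have h1 : (4 * i + 3) % 2 = 1 := by omega
  have h2 : (4 * i + 3) / 2 = 2 * i + 1 := by omega
  have h3 : (2 * i + 1) % 2 = 1 := by omega
  have h4 : (2 * i + 1 + 1) / 2 = i + 1 := by omega
  simp only [stateCode, kappaCode, iotaCode, h1, h2, h3, h4, one_ne_zero, if_false]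
  refine congrArg s.2 ?_
  push_cast
  ring

/-! ### Frequencies of parities in random microscopic states -/

/-- Pulling back along `Φ` reduces to independent sites: injectivity of `a` and disjointness of the
`B j` make the covariances vanish. -/
theorem MLRandom.eventually_oddCount {m₀ : Set.Icc (-1 : ℝ) 1} {m₁ : unitInterval}
    {Φ : MicroState → MicroState} (hΦ : Measurable Φ) {s : MicroState}
    (hs : MLRandom ((gibbsMeasure m₀ m₁).map Φ) s) {P : ℕ → List ℕ} (hP : Primrec P) {K : ℕ}
    (hK : ∀ j, ∀ p ∈ P j, p < K * (j + 1)) {a : ℕ → ℤ} (ha : Function.Injective a)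
    {B : ℕ → Finset ℤ} (hB : ∀ i j, i ≠ j → Disjoint (B i) (B j)) {n : ℕ}
    (hn : ∀ j, (B j).card = n)
    (hPB : ∀ j u, sgn (parity (stateCode (Φ u)) (P j)) =
      sgn (u.1 (a j)) * ∏ b ∈ B j, sgn (u.2 b))
    {R : ℕ → ℕ → Prop} (hR : PrimrecRel R) {δ : ℝ} (hδ : 0 < δ)
    (hRδ : ∀ c N : ℕ, R c N →
      δ * N ≤ |(N - 2 * c : ℝ) - N * (-(m₀ : ℝ) * (1 - 2 * (m₁ : ℝ)) ^ n)|) :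
    ∀ᶠ k in Filter.atTop, ¬ R (oddCount P (stateCode s) (4 ^ k)) (4 ^ k) := by
  have hm : Measurable fun u => stateCode (Φ u) := measurable_stateCode.comp hΦ
  have hlaw : ((gibbsMeasure m₀ m₁).map Φ).map stateCode =
      (gibbsMeasure m₀ m₁).map fun u => stateCode (Φ u) :=
    Measure.map_map measurable_stateCode hΦ
  rw [MLRandom, hlaw] at hs
  have := Measure.isProbabilityMeasure_map (μ := gibbsMeasure m₀ m₁) hm.aemeasurable
  have hsgn : ∀ l, Measurable fun w : ℕ → Bool => sgn (parity w l) := fun l =>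
    measurable_sgn.comp (measurable_parity l)
  refine MLRandomNat.eventually_oddCount hs hP hK (fun j => ?_) (fun i j hij => ?_) hR hδ hRδ
  · rw [integral_map hm.aemeasurable (hsgn _).aestronglyMeasurable]
    simp only [hPB]
    simpa [hn] using integral_prod_sgn_gibbsMeasure m₀ m₁ {a j} (B j)
  · rw [integral_map hm.aemeasurable (Measurable.aestronglyMeasurable (by fun_prop))]
    have h := integral_prod_sgn_gibbsMeasure m₀ m₁ {a i, a j} (B i ∪ B j)
    rw [Finset.card_union_of_disjoint (hB i j hij), hn, hn,
      Finset.card_pair fun h => hij (ha h)] at h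
    simp only [Finset.prod_union (hB i j hij), Finset.prod_pair fun h => hij (ha h)] at h
    simp only [hPB]
    rw [show (-(m₀ : ℝ) * (1 - 2 * (m₁ : ℝ)) ^ n) ^ 2
      = (-(m₀ : ℝ)) ^ 2 * (1 - 2 * (m₁ : ℝ)) ^ (n + n) by ring, ← h]
    exact integral_congr_ae (ae_of_all _ fun u => by ring)

/-! ### Rational thresholds for the frequency of odd blocks -/

theorem primrecRel_mul_le_mul (d q : ℕ) : PrimrecRel fun c N : ℕ => d * c ≤ q * N :=
  Primrec.nat_le.comp (Primrec.nat_mul.comp (Primrec.const d) Primrec.fst)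
    (Primrec.nat_mul.comp (Primrec.const q) Primrec.snd)

theorem primrecRel_mul_ge_mul (d q : ℕ) : PrimrecRel fun c N : ℕ => q * N ≤ d * c :=
  Primrec.nat_le.comp (Primrec.nat_mul.comp (Primrec.const q) Primrec.snd)
    (Primrec.nat_mul.comp (Primrec.const d) Primrec.fst)

/-- The sign sum is `N - 2 * c`, so mean `e` means an expected odd frequency `(1 - e) / 2`; the
deviation rate is twice the gap from it to `q / d`. -/
theorem deviation_of_mul_ge_mul {d q c N : ℕ} (hd : 0 < d) {e : ℝ} (h : q * N ≤ d * c) :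
    (2 * (q / d : ℝ) - (1 - e)) * N ≤ |(N - 2 * c : ℝ) - N * e| := by
  have hd' : (0 : ℝ) < d := by exact_mod_cast hd
  have h' : (q : ℝ) / d * N ≤ c := by
    rw [div_mul_eq_mul_div, div_le_iff₀ hd', mul_comm (c : ℝ)]
    exact_mod_cast h
  refine le_trans ?_ (neg_le_abs _)
  nlinarith

theorem deviation_of_mul_le_mul {d q c N : ℕ} (hd : 0 < d) {e : ℝ} (h : d * c ≤ q * N) :
    ((1 - e) - 2 * (q / d : ℝ)) * N ≤ |(N - 2 * c : ℝ) - N * e| := by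
  have hd' : (0 : ℝ) < d := by exact_mod_cast hd
  have h' : (c : ℝ) ≤ q / d * N := by
    rw [div_mul_eq_mul_div, le_div_iff₀ hd', mul_comm (c : ℝ)]
    exact_mod_cast h
  refine le_trans ?_ (le_abs_self _)
  nlinarith

/-! ### The Kac chain -/

theorem kacStep_iterate_snd (t : ℕ) (s : MicroState) : (kacStep^[t] s).2 = s.2 := by
  induction t with
  | zero => rfl
  | succ t ih =>
    rw [Function.iterate_succ_apply']
    exact ih

theorem sgn_kacStep_iterate (t : ℕ) (s : MicroState) (i : ℤ) :
    sgn ((kacStep^[t] s).1 i) =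
      sgn (s.1 (i - t)) * ∏ k ∈ Finset.range t, sgn (s.2 (i - 1 - k)) := by
  induction t generalizing i with
  | zero => simp
  | succ t ih =>
    rw [Function.iterate_succ_apply']
    change sgn (xor ((kacStep^[t] s).1 (i - 1)) ((kacStep^[t] s).2 (i - 1))) = _
    rw [sgn_xor, ih, kacStep_iterate_snd, Finset.prod_range_succ', mul_assoc,
      show i - 1 - (t : ℤ) = i - (t + 1 : ℕ) by push_cast; ring]
    congr 2
    · refine Finset.prod_congr rfl fun k _ => congrArg (fun l => sgn (s.2 l)) ?_
      push_cast
      ring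
    · simp

/-- Positions in the code of `u` of the spin at site `i = 2 t (j + 1)` and of the scatterers at
the sites `i - t, …, i - 1`. -/
def forwardBlock (t j : ℕ) : List ℕ :=
  4 * (2 * (t * (j + 1))) ::
    (List.range t).map fun k => 4 * (2 * (t * (j + 1)) - 1 - k) + 1

/-- Positions in the code of `u` of the spin at site `-i - t`, where `i = 2 t (j + 1)`, and of the
scatterers at the sites `-i - t, …, -i + t - 1`. -/
def reversedBlock (t j : ℕ) : List ℕ :=
  (4 * (2 * (t * (j + 1)) + t - 1) + 2) ::
    (((List.range t).map fun k => 4 * (2 * (t * (j + 1)) + k) + 3) ++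
      (List.range t).map fun k => 4 * (2 * (t * (j + 1)) - k - 1) + 3)

theorem primrec_forwardBlock (t : ℕ) : Primrec (forwardBlock t) := by
  have hi : Primrec fun j : ℕ => 2 * (t * (j + 1)) :=
    Primrec.nat_mul.comp (Primrec.const 2)
      (Primrec.nat_mul.comp (Primrec.const t) Primrec.succ)
  refine Primrec.list_cons.comp (Primrec.nat_mul.comp (Primrec.const 4) hi)
    (Primrec.list_map (Primrec.const _) ?_)
  exact Primrec.succ.comp (Primrec.nat_mul.comp (Primrec.const 4) (Primrec.nat_sub.comp
    (Primrec.nat_sub.comp (hi.comp Primrec.fst) (Primrec.const 1)) Primrec.snd))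

theorem primrec_reversedBlock (t : ℕ) : Primrec (reversedBlock t) := by
  have hi : Primrec fun j : ℕ => 2 * (t * (j + 1)) :=
    Primrec.nat_mul.comp (Primrec.const 2)
      (Primrec.nat_mul.comp (Primrec.const t) Primrec.succ)
  have hi' : Primrec fun x : ℕ × ℕ => 2 * (t * (x.1 + 1)) := hi.comp Primrec.fst
  refine Primrec.list_cons.comp ?_ (Primrec.list_append.comp
    (Primrec.list_map (Primrec.const _) ?_) (Primrec.list_map (Primrec.const _) ?_))
  · exact Primrec.nat_add.comp (Primrec.nat_mul.comp (Primrec.const 4) (Primrec.nat_sub.comp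
      (Primrec.nat_add.comp hi (Primrec.const t)) (Primrec.const 1))) (Primrec.const 2)
  · exact Primrec.nat_add.comp (Primrec.nat_mul.comp (Primrec.const 4)
      (Primrec.nat_add.comp hi' Primrec.snd)) (Primrec.const 3)
  · exact Primrec.nat_add.comp (Primrec.nat_mul.comp (Primrec.const 4) (Primrec.nat_sub.comp
      (Primrec.nat_sub.comp hi' Primrec.snd) (Primrec.const 1))) (Primrec.const 3)

theorem lt_of_mem_forwardBlock {t j p : ℕ} (hp : p ∈ forwardBlock t j) :
    p < (12 * t + 2) * (j + 1) := by
  rw [add_mul, mul_assoc]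
  simp only [forwardBlock, List.mem_cons, List.mem_map, List.mem_range] at hp
  generalize t * (j + 1) = m at *
  rcases hp with rfl | ⟨k, hk, rfl⟩ <;> omega

theorem lt_of_mem_reversedBlock {t j p : ℕ} (ht : 0 < t) (hp : p ∈ reversedBlock t j) :
    p < (12 * t + 2) * (j + 1) := by
  rw [add_mul, mul_assoc]
  have hm : t ≤ t * (j + 1) := Nat.le_mul_of_pos_right t j.succ_pos
  simp only [reversedBlock, List.mem_cons, List.mem_append, List.mem_map, List.mem_range] at hp
  generalize t * (j + 1) = m at *
  rcases hp with rfl | ⟨k, hk, rfl⟩ | ⟨k, hk, rfl⟩ <;> omega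

theorem list_prod_map_range (f : ℕ → ℝ) (n : ℕ) :
    ((List.range n).map f).prod = ∏ k ∈ Finset.range n, f k := rfl

theorem sgn_parity_forwardBlock (t j : ℕ) (u : MicroState) :
    sgn (parity (stateCode u) (forwardBlock t j)) =
      sgn (u.1 (2 * (t * (j + 1)) : ℕ)) *
        ∏ k ∈ Finset.range t, sgn (u.2 ((2 * (t * (j + 1)) : ℕ) - 1 - k)) := by
  -- Keeps the truncated subtractions in the block exact and the sites nonnegative.
  have hm : t ≤ t * (j + 1) := Nat.le_mul_of_pos_right t j.succ_pos
  rw [sgn_parity, forwardBlock, List.map_cons, List.prod_cons, List.map_map,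
    list_prod_map_range, stateCode_four_mul]
  congr 1
  refine Finset.prod_congr rfl fun k hk => ?_
  rw [Finset.mem_range] at hk
  simp only [Function.comp_apply, stateCode_four_mul_add_one]
  exact congrArg (fun l => sgn (u.2 l)) (by omega)

theorem sgn_parity_reversedBlock {t : ℕ} (ht : 0 < t) (j : ℕ) (u : MicroState) :
    sgn (parity (stateCode u) (reversedBlock t j)) =
      sgn (u.1 (-(2 * (t * (j + 1)) : ℕ) - t)) *
        ((∏ k ∈ Finset.range t, sgn (u.2 (-(2 * (t * (j + 1)) : ℕ) - 1 - k))) *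
          ∏ k ∈ Finset.range t, sgn (u.2 (-(2 * (t * (j + 1)) : ℕ) + k))) := by
  have hm : t ≤ t * (j + 1) := Nat.le_mul_of_pos_right t j.succ_pos
  rw [sgn_parity, reversedBlock, List.map_cons, List.prod_cons, List.map_append,
    List.prod_append, List.map_map, List.map_map, list_prod_map_range, list_prod_map_range,
    stateCode_four_mul_add_two]
  congr 1
  · exact congrArg (fun l => sgn (u.1 l)) (by omega)
  congr 1
  all_goals
    refine Finset.prod_congr rfl fun k hk => ?_
    rw [Finset.mem_range] at hk
    simp only [Function.comp_apply, stateCode_four_mul_add_three]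
    exact congrArg (fun l => sgn (u.2 l)) (by omega)

/-- The reflection `l ↦ -l - 1` carries the scatterer sites `i - t, …, i - 1` to `-i, …, -i + t -
1`, while the spin now at `-i` has crossed `-i - t, …, -i - 1`. -/
theorem parity_timeReversal {t : ℕ} (ht : 0 < t) (j : ℕ) (s : MicroState) :
    parity (stateCode (timeReversal (kacStep^[t] s))) (forwardBlock t j) =
      parity (stateCode s) (reversedBlock t j) := by
  apply sgn_injective
  rw [sgn_parity_forwardBlock, sgn_parity_reversedBlock ht]
  simp only [timeReversal]
  rw [sgn_kacStep_iterate, kacStep_iterate_snd, mul_assoc]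
  congr 2
  exact Finset.prod_congr rfl fun k _ => congrArg (fun l => sgn (s.2 l)) (by ring)

/-- The sites `-i - t, …, -i + t - 1`, where `i = 2 t (j + 1)`. -/
def reversedSites (t j : ℕ) : Finset ℤ :=
  (Finset.range t).image (fun k : ℕ => -((2 * (t * (j + 1)) : ℕ) : ℤ) - 1 - k) ∪
    (Finset.range t).image (fun k : ℕ => -((2 * (t * (j + 1)) : ℕ) : ℤ) + k)

theorem disjoint_reversedSites_parts (i : ℤ) (t : ℕ) :
    Disjoint ((Finset.range t).image fun k : ℕ => i - 1 - k)
      ((Finset.range t).image fun k : ℕ => i + k) := by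
  rw [Finset.disjoint_left]
  simp only [Finset.mem_image, Finset.mem_range]
  rintro _ ⟨k, hk, rfl⟩ ⟨l, hl, h⟩
  omega

theorem card_reversedSites (t j : ℕ) : (reversedSites t j).card = 2 * t := by
  rw [reversedSites, Finset.card_union_of_disjoint (disjoint_reversedSites_parts _ t),
    Finset.card_image_of_injective _ fun k l h => by simpa using h,
    Finset.card_image_of_injective _ fun k l h => by simpa using h, Finset.card_range]
  ring

theorem mem_reversedSites {t j : ℕ} {b : ℤ} (hb : b ∈ reversedSites t j) :
    -(2 * (t * (j + 1)) : ℤ) - t ≤ b ∧ b < -(2 * (t * (j + 1)) : ℤ) + t := by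
  simp only [reversedSites, Finset.mem_union, Finset.mem_image, Finset.mem_range] at hb
  push_cast at hb
  generalize (t : ℤ) * (j + 1) = m at *
  rcases hb with ⟨k, hk, rfl⟩ | ⟨k, hk, rfl⟩ <;> omega

/-- The windows have length `2t`, equal to the spacing of the sites `2t(j + 1)`. -/
theorem disjoint_reversedSites (t : ℕ) {i j : ℕ} (hij : i ≠ j) :
    Disjoint (reversedSites t i) (reversedSites t j) := by
  rw [Finset.disjoint_left]
  intro b hi hj
  have h1 := mem_reversedSites hi
  have h2 := mem_reversedSites hj
  rcases hij.lt_or_gt with h | h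
  · have : (t : ℤ) * (i + 1) + t ≤ t * (j + 1) := by
      have : (i : ℤ) + 1 ≤ j := by exact_mod_cast h
      nlinarith
    omega
  · have : (t : ℤ) * (j + 1) + t ≤ t * (i + 1) := by
      have : (j : ℤ) + 1 ≤ i := by exact_mod_cast h
      nlinarith
    omega

/-! ### The two frequencies and their incompatibility -/

theorem MLRandom.eventually_forward {m₀ : Set.Icc (-1 : ℝ) 1} {m₁ : unitInterval} {t : ℕ}
    (ht : 0 < t) {u : MicroState} (hu : MLRandom (gibbsMeasureAt m₀ m₁ t) u)
    {R : ℕ → ℕ → Prop} (hR : PrimrecRel R) {δ : ℝ} (hδ : 0 < δ)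
    (hRδ : ∀ c N : ℕ, R c N → δ * N ≤ |(N - 2 * c : ℝ) - N * (-(m₀ : ℝ))|) :
    ∀ᶠ k in Filter.atTop, ¬ R (oddCount (forwardBlock t) (stateCode u) (4 ^ k)) (4 ^ k) := by
  refine MLRandom.eventually_oddCount (measurable_kacStep.iterate t) hu (primrec_forwardBlock t)
    (fun j p hp => lt_of_mem_forwardBlock hp) (a := fun j => ((2 * (t * (j + 1)) : ℕ) : ℤ) - t)
    (fun i j h => ?_) (B := fun _ => ∅) (fun _ _ _ => Finset.disjoint_empty_left _) (n := 0)
    (fun _ => rfl) (fun j v => ?_) hR hδ (by simpa using hRδ)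
  · have h' : 2 * (t * (i + 1)) = 2 * (t * (j + 1)) := by
      have : ((2 * (t * (i + 1)) : ℕ) : ℤ) = (2 * (t * (j + 1)) : ℕ) := by linarith
      exact_mod_cast this
    have := Nat.eq_of_mul_eq_mul_left ht (Nat.eq_of_mul_eq_mul_left two_pos h')
    omega
  -- The block contains exactly the scatterers crossed in `t` steps, so their signs occur squared
  -- and disappear.
  · rw [sgn_parity_forwardBlock, sgn_kacStep_iterate, kacStep_iterate_snd, mul_assoc,
      ← Finset.prod_mul_distrib]
    simp [sgn_mul_self]

theorem MLRandom.eventually_reversed {m₀ : Set.Icc (-1 : ℝ) 1} {m₁ : unitInterval} {t : ℕ}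
    (ht : 0 < t) {s : MicroState} (hs : MLRandom (gibbsMeasure m₀ m₁) s)
    {R : ℕ → ℕ → Prop} (hR : PrimrecRel R) {δ : ℝ} (hδ : 0 < δ)
    (hRδ : ∀ c N : ℕ, R c N →
      δ * N ≤ |(N - 2 * c : ℝ) - N * (-(m₀ : ℝ) * (1 - 2 * (m₁ : ℝ)) ^ (2 * t))|) :
    ∀ᶠ k in Filter.atTop, ¬ R (oddCount (reversedBlock t) (stateCode s) (4 ^ k)) (4 ^ k) := by
  rw [← Measure.map_id (μ := gibbsMeasure m₀ m₁)] at hs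
  refine MLRandom.eventually_oddCount measurable_id hs (primrec_reversedBlock t)
    (fun j p hp => lt_of_mem_reversedBlock ht hp)
    (a := fun j => -((2 * (t * (j + 1)) : ℕ) : ℤ) - t)
    (fun i j h => ?_) (fun i j hij => disjoint_reversedSites t hij) (card_reversedSites t)
    (fun j v => ?_) hR hδ hRδ
  · have h' : 2 * (t * (i + 1)) = 2 * (t * (j + 1)) := by
      have : ((2 * (t * (i + 1)) : ℕ) : ℤ) = (2 * (t * (j + 1)) : ℕ) := by linarith
      exact_mod_cast this
    have := Nat.eq_of_mul_eq_mul_left ht (Nat.eq_of_mul_eq_mul_left two_pos h')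
    omega
  · rw [id, sgn_parity_reversedBlock ht, reversedSites,
      Finset.prod_union (disjoint_reversedSites_parts _ t),
      Finset.prod_image fun k _ l _ h => by simpa using h,
      Finset.prod_image fun k _ l _ h => by simpa using h]

theorem exists_nat_div_between {x y : ℝ} (hx : 0 ≤ x) (hxy : x < y) :
    ∃ q d : ℕ, 0 < d ∧ x < (q / d : ℝ) ∧ (q / d : ℝ) < y := by
  obtain ⟨r, h1, h2⟩ := exists_rat_btwn hxy
  have hr : 0 ≤ r := by exact_mod_cast hx.trans h1.le
  refine ⟨r.num.toNat, r.den, r.den_pos, ?_⟩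
  have h : ((r.num.toNat : ℝ) / r.den) = r := by
    rw [Rat.cast_def r]
    congr 1
    exact_mod_cast Int.toNat_of_nonneg (Rat.num_nonneg.2 hr)
  rw [h]
  exact ⟨h1, h2⟩

theorem theorem4 (m₀ : Set.Icc (-1 : ℝ) 1) (m₁ : unitInterval)
    (hc₀ : ComputableReal (m₀ : ℝ)) (hc₁ : ComputableReal (m₁ : ℝ))
    (hm₀ : (m₀ : ℝ) ≠ 0)
    (hm₁ : (m₁ : ℝ) ≠ 0) (hm₁_half : (m₁ : ℝ) ≠ 1 / 2) (hm₁_one : (m₁ : ℝ) ≠ 1)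
    (s : MicroState) (hs : MLRandom (gibbsMeasure m₀ m₁) s)
    (t : ℕ) (ht : t ≠ 0) :
    ¬ MLRandom (gibbsMeasureAt m₀ m₁ t) (timeReversal (kacStep^[t] s)) := by
  intro hu
  have ht' : 0 < t := Nat.pos_of_ne_zero ht
  have hcount : ∀ N, oddCount (forwardBlock t) (stateCode (timeReversal (kacStep^[t] s))) N =
      oddCount (reversedBlock t) (stateCode s) N := fun N => by
    induction N with
    | zero => rfl
    | succ N ih =>
      simp only [oddCount] at ih ⊢
      rw [ih, parity_timeReversal ht']
  set r : ℝ := (1 - 2 * (m₁ : ℝ)) ^ (2 * t) with hr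
  have hr0 : 0 ≤ r := (even_two_mul t).pow_nonneg _
  have hr1 : r < 1 := by
    have h0 : 0 < (m₁ : ℝ) := lt_of_le_of_ne m₁.2.1 hm₁.symm
    have h1 : (m₁ : ℝ) < 1 := lt_of_le_of_ne m₁.2.2 hm₁_one
    rw [hr, pow_mul]
    exact pow_lt_one₀ (sq_nonneg _) (by nlinarith) ht
  have hm := m₀.2
  rcases lt_or_gt_of_ne hm₀ with h0 | h0
  -- The expected odd frequencies are `(1 + m₀) / 2` under `μ_{m,t}` and `(1 + m₀ r) / 2` under
  -- `μ_m`; for `m₀ < 0` the first is smaller, and for `m₀ > 0` the roles are exchanged.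
  · obtain ⟨q, d, hd, h1, h2⟩ := exists_nat_div_between (x := (1 - -(m₀ : ℝ)) / 2)
      (y := (1 - -(m₀ : ℝ) * r) / 2) (by linarith [hm.1]) (by nlinarith)
    have e1 := hu.eventually_forward ht' (primrecRel_mul_ge_mul d q)
      (δ := 2 * (q / d : ℝ) - (1 - -(m₀ : ℝ))) (by linarith)
      fun c N h => deviation_of_mul_ge_mul hd h
    have e2 := hs.eventually_reversed ht' (primrecRel_mul_le_mul d q)
      (δ := (1 - -(m₀ : ℝ) * r) - 2 * (q / d : ℝ)) (by linarith)
      fun c N h => deviation_of_mul_le_mul hd h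
    simp only [hcount] at e1
    -- At one `k` the common count is both below and above `q / d * 4 ^ k`.
    obtain ⟨k, hk1, hk2⟩ := (e1.and e2).exists
    exact hk1 (not_le.1 hk2).le
  · obtain ⟨q, d, hd, h1, h2⟩ := exists_nat_div_between (x := (1 - -(m₀ : ℝ) * r) / 2)
      (y := (1 - -(m₀ : ℝ)) / 2) (by nlinarith) (by nlinarith)
    have e1 := hu.eventually_forward ht' (primrecRel_mul_le_mul d q)
      (δ := (1 - -(m₀ : ℝ)) - 2 * (q / d : ℝ)) (by linarith)
      fun c N h => deviation_of_mul_le_mul hd h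
    have e2 := hs.eventually_reversed ht' (primrecRel_mul_ge_mul d q)
      (δ := 2 * (q / d : ℝ) - (1 - -(m₀ : ℝ) * r)) (by linarith)
      fun c N h => deviation_of_mul_ge_mul hd h
    simp only [hcount] at e1
    obtain ⟨k, hk1, hk2⟩ := (e1.and e2).exists
    exact hk1 (not_le.1 hk2).le
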